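/- Let $d\ge 1$ and let $(\Lambda_t)_{t\ge 0}$ be a dynamical map on $M_d(\mathbb{C})$, i.e. a family of completely positive, trace-preserving linear maps with $\Lambda_0=\mathrm{id}$. Suppose that $\Lambda_t$ is differentiable in $t\ge 0$ (one-sidedly at $t=0$) and solves the local master equation $\frac{d}{dt}\Lambda_t=L_t\Lambda_t$ for all $t\ge 0$, where each $L_t$ is a linear map on $M_d(\mathbb{C})$, and that $\Lambda_t$ is invertible as a linear map for every $t\ge0$ (the inverse need not be positive; this is automatic if $t\mapsto L_t$ is continuous). Call $\Lambda_t$ divisible if for all $t\ge s\ge 0$ there is a completely positive linear map $V_{t,s}$ (the propagator) on $M_d(\mathbb{C})$ with $\Lambda_t=V_{t,s}\Lambda_s$. Then $\Lambda_t$ is divisible if and only if for every $t\ge0$ the map $L_t$ has the GKSL form, i.e. there are a Hermitian matrix $H_t$ and finitely many matrices $V_\alpha(t)$ with $$L_t\rho=-i[H_t,\rho]+\frac12\sum_\alpha\Big([V_\alpha(t),\rho V_\alpha(t)^\dagger]+[V_\alpha(t)\rho,V_\alpha(t)^\dagger]\Big)\qquad(\rho\in M_d(\mathbb{C})).$$ Moreover,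 let $F_0,\dots,F_{d^2-1}$ be any basis of $M_d(\mathbb{C})$ that is orthonormal for the inner product $\operatorname{tr}(A^\dagger B)$ and has $F_0=\mathbb{I}_d/\sqrt d$. Then $\Lambda_t$ is divisible if and only if for every $t\ge 0$ there are a Hermitian matrix $H_t$ and a positive semidefinite matrix $(a_{kl}(t))_{k,l=1}^{d^2-1}$ with $$L_t\rho=-i[H_t,\rho]+\sum_{k,l=1}^{d^2-1}a_{kl}(t)\Big(F_k\rho F_l^\dagger-\frac12\{F_l^\dagger F_k,\rho\}\Big)\qquad(\rho\in M_d(\mathbb{C})).$$ -/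

import Mathlib

open Set Matrix
open scoped ComplexOrder

/-- Linear maps on the `d × d` complex matrices, i.e. on the operators of a `d`-level system.
The product of this algebra is composition, and `1` is the identity map. -/
abbrev SuperOp (d : ℕ) : Type :=
  Module.End ℂ (Matrix (Fin d) (Fin d) ℂ)

open scoped Matrix.Norms.L2Operator MatrixOrder CStarAlgebra in
/-- Complete positivity: `Φ` is the underlying linear map of a completely positive map of the
C⋆-algebra of `d × d` matrices, whose nonnegative elements are the positive semidefinite
matrices. -/
def IsCompletelyPositive {d : ℕ} (Φ : SuperOp d) : Prop :=
  ∃ Ψ : Matrix (Fin d) (Fin d) ℂ →CP Matrix (Fin d) (Fin d) ℂ, Ψ.toLinearMap = Φ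

/-- `Φ` preserves the trace. -/
def IsTracePreserving {d : ℕ} (Φ : SuperOp d) : Prop :=
  ∀ ρ : Matrix (Fin d) (Fin d) ℂ, (Φ ρ).trace = ρ.trace

/-- A (quantum) dynamical map: a family `Λ t`, `t ≥ 0`, of completely positive trace-preserving
maps that starts at the identity. -/
structure IsDynamicalMap {d : ℕ} (Λ : ℝ → SuperOp d) : Prop where
  initial : Λ 0 = 1
  completelyPositive : ∀ t : ℝ, 0 ≤ t → IsCompletelyPositive (Λ t)
  tracePreserving : ∀ t : ℝ, 0 ≤ t → IsTracePreserving (Λ t)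

/-- `Λ` is a differentiable solution on `[0, ∞)` of the local master equation
`dΛ_t/dt = L_t Λ_t` (at `t = 0` the derivative is one-sided). On a finite-dimensional space it is
the same to differentiate `Λ_t` or all the `Λ_t ρ`. -/
def SolvesMasterEquation {d : ℕ} (L Λ : ℝ → SuperOp d) : Prop :=
  ∀ t : ℝ, 0 ≤ t → ∀ ρ : Matrix (Fin d) (Fin d) ℂ,
    HasDerivWithinAt (fun u : ℝ => Λ u ρ) (L t (Λ t ρ)) (Ici 0) t

/-- Divisibility: for all `t ≥ s ≥ 0` one has `Λ_t = V_{t,s} Λ_s` with a completely positive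
propagator `V_{t,s}`. -/
def IsDivisible {d : ℕ} (Λ : ℝ → SuperOp d) : Prop :=
  ∀ s t : ℝ, 0 ≤ s → s ≤ t →
    ∃ V : SuperOp d, IsCompletelyPositive V ∧ Λ t = V * Λ s

/-- The GKSL form with noise operators `V_α`:
`L ρ = -i [H, ρ] + 1/2 ∑_α ([V_α, ρ V_α†] + [V_α ρ, V_α†])`. -/
def IsGKSL {d : ℕ} (L : SuperOp d) : Prop :=
  ∃ (H : Matrix (Fin d) (Fin d) ℂ) (m : ℕ) (V : Fin m → Matrix (Fin d) (Fin d) ℂ),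
    H.IsHermitian ∧
      ∀ ρ : Matrix (Fin d) (Fin d) ℂ,
        L ρ = -(Complex.I • ⁅H, ρ⁆) +
          (1 / 2 : ℂ) • ∑ α, (⁅V α, ρ * (V α)ᴴ⁆ + ⁅V α * ρ, (V α)ᴴ⁆)

/-- `F_0, …, F_{d² - 1}` is an orthonormal basis of the `d × d` matrices for the Hilbert-Schmidt
inner product `tr (A† B)`, with `F_0 = 𝕀 / √d`. (Being orthonormal and `d²` in number, the `F_α`
form a basis.) -/
structure IsOperatorBasis {d : ℕ} [NeZero d]
    (F : Fin (d ^ 2) → Matrix (Fin d) (Fin d) ℂ) : Prop where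
  orthonormal : ∀ α β, ((F α)ᴴ * F β).trace = if α = β then 1 else 0
  zero_eq : F 0 = ((Real.sqrt d : ℝ) : ℂ)⁻¹ • (1 : Matrix (Fin d) (Fin d) ℂ)

/-- The GKSL form with a positive coefficient matrix `a_{kl}` with respect to the
matrices `F_k`, `k = 1, …, d² - 1`:
`L ρ = -i [H, ρ] + ∑_{k,l} a_{kl} (F_k ρ F_l† - 1/2 {F_l† F_k, ρ})`. -/
def IsGKSLWith {d : ℕ} [NeZero d] (F : Fin (d ^ 2) → Matrix (Fin d) (Fin d) ℂ)
    (L : SuperOp d) : Prop :=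
  ∃ (H : Matrix (Fin d) (Fin d) ℂ)
    (a : Matrix {k : Fin (d ^ 2) // k ≠ 0} {k : Fin (d ^ 2) // k ≠ 0} ℂ),
    H.IsHermitian ∧ a.PosSemidef ∧
      ∀ ρ : Matrix (Fin d) (Fin d) ℂ,
        L ρ = -(Complex.I • ⁅H, ρ⁆) +
          ∑ k, ∑ l, a k l •
            (F k * ρ * (F l)ᴴ -
              (1 / 2 : ℂ) • ((F l)ᴴ * F k * ρ + ρ * ((F l)ᴴ * F k)))

/-! Complete positivity is handled through Choi matrices and Kraus operators. If `Λ` is divisible,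
the maps `Λ_u Λ_t⁻¹`, `u > t`, are completely positive and leave the identity with right derivative
`L_t`. The Choi matrix of the identity is the rank-one matrix built on `vecOne`, so the Choi matrix
of `L_t` is positive on the complement of `vecOne`. Compressing to that complement yields traceless
Kraus operators (`exists_traceless_kraus`), and `tr (L_t ρ) = 0` fixes the Hermitian part of the
remaining drift (`exists_hamiltonian_of_trace_eq_zero`). Being traceless, the Kraus operators expand
in the `F_k` with `k ≠ 0`.

For the converse, `L_t` need not be continuous in `t`, so the argument works directly with the path
of propagators. Among maps with Hermitian Choi matrix, `defect` is Lipschitz and is nonpositive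
exactly at the completely positive ones; composing on the left with a completely positive map that
increases traces by a factor at most `k` multiplies it by at most `k`. An Euler step `1 + h L` with
a GKSL generator becomes such a map, with `k = 1 + O(h²)`, after an `O(h²)` correction
(`IsGKSL.exists_step`). Hence the right slopes of the defect along the path have upper limit at most
`0`, and a defect that starts nonpositive stays so (`isCompletelyPositive_of_hasDerivWithinAt`). -/

/-! ### Choi matrices and Kraus operators -/

section CompletePositivity

variable {d : ℕ}

/-- The Choi matrix of a superoperator, as a linear map. -/
def choi : SuperOp d →ₗ[ℂ] Matrix (Fin d × Fin d) (Fin d × Fin d) ℂ where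
  toFun Φ := Matrix.of fun p q => Φ (Matrix.single p.2 q.2 1) p.1 q.1
  map_add' _ _ := by ext; simp
  map_smul' _ _ := by ext; simp

lemma choi_apply (Φ : SuperOp d) (p q : Fin d × Fin d) :
    choi Φ p q = Φ (Matrix.single p.2 q.2 1) p.1 q.1 := rfl

lemma superOp_apply_eq_sum_choi (Φ : SuperOp d) (ρ : Matrix (Fin d) (Fin d) ℂ) (i j : Fin d) :
    Φ ρ i j = ∑ a, ∑ b, ρ a b * choi Φ (i, a) (j, b) := by
  conv_lhs => rw [matrix_eq_sum_single ρ]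
  simp only [map_sum, Matrix.sum_apply, choi_apply]
  refine Finset.sum_congr rfl fun a _ => Finset.sum_congr rfl fun b _ => ?_
  have : Matrix.single a b (ρ a b) = ρ a b • Matrix.single a b (1 : ℂ) := by simp
  rw [this, map_smul, Matrix.smul_apply, smul_eq_mul]

lemma choi_injective : Function.Injective (choi (d := d)) := by
  intro Φ Ψ h
  refine LinearMap.ext fun ρ => Matrix.ext fun i j => ?_
  rw [superOp_apply_eq_sum_choi, superOp_apply_eq_sum_choi, h]

lemma mul_mul_conjTranspose_apply_eq_sum (K ρ M : Matrix (Fin d) (Fin d) ℂ) (i j : Fin d) :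
    (K * ρ * Mᴴ) i j = ∑ a, ∑ b, ρ a b * (K i a * star (M j b)) := by
  simp only [Matrix.mul_apply, Matrix.conjTranspose_apply, Finset.sum_mul]
  rw [Finset.sum_comm]
  exact Finset.sum_congr rfl fun a _ => Finset.sum_congr rfl fun b _ => by ring

lemma mul_single_mul_conjTranspose_apply (K M : Matrix (Fin d) (Fin d) ℂ) (i j a b : Fin d) :
    (K * Matrix.single a b (1 : ℂ) * Mᴴ) i j = K i a * star (M j b) := by
  rw [mul_mul_conjTranspose_apply_eq_sum]
  simp [Matrix.single_apply, ite_and]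

/-- If the Choi matrix is a Gram matrix, then the rows of a factor are Kraus operators. -/
lemma eq_sum_kraus_of_choi_eq {ι : Type*} [Fintype ι] {Φ : SuperOp d}
    {B : Matrix ι (Fin d × Fin d) ℂ} (h : choi Φ = Bᴴ * B) (ρ : Matrix (Fin d) (Fin d) ℂ) :
    Φ ρ = ∑ m, (Matrix.of fun i a => star (B m (i, a))) * ρ *
      (Matrix.of fun i a => star (B m (i, a)))ᴴ := by
  ext i j
  rw [superOp_apply_eq_sum_choi, h, Matrix.sum_apply]
  simp only [mul_mul_conjTranspose_apply_eq_sum]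
  simp only [Matrix.mul_apply, Finset.mul_sum, Matrix.conjTranspose_apply, Matrix.of_apply,
    star_star]
  exact (Finset.sum_congr rfl fun a _ => Finset.sum_comm).trans Finset.sum_comm

/-- A positive semidefinite matrix is a Gram matrix. -/
lemma exists_eq_conjTranspose_mul_self {n : Type*} [Fintype n] {A : Matrix n n ℂ}
    (hA : A.PosSemidef) : ∃ B : Matrix n n ℂ, A = Bᴴ * B := by
  classical
  open scoped MatrixOrder Matrix.Norms.L2Operator in
  exact CStarAlgebra.nonneg_iff_eq_star_mul_self.mp hA.nonneg

lemma exists_kraus_of_posSemidef_choi {Φ : SuperOp d} (h : (choi Φ).PosSemidef) :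
    ∃ K : Fin d × Fin d → Matrix (Fin d) (Fin d) ℂ, ∀ ρ, Φ ρ = ∑ m, K m * ρ * (K m)ᴴ := by
  obtain ⟨B, hB⟩ := exists_eq_conjTranspose_mul_self h
  exact ⟨_, eq_sum_kraus_of_choi_eq hB⟩

-- Conjugation by the block-diagonal matrix with `K m` on the diagonal acts as `K m · (K m)†` on
-- each block and preserves nonnegativity; the amplification of `Φ` is a sum of these.
open scoped Matrix.Norms.L2Operator MatrixOrder CStarAlgebra in
lemma isCompletelyPositive_of_kraus {ι : Type*} [Fintype ι] {Φ : SuperOp d}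
    (K : ι → Matrix (Fin d) (Fin d) ℂ) (h : ∀ ρ, Φ ρ = ∑ m, K m * ρ * (K m)ᴴ) :
    IsCompletelyPositive Φ := by
  refine ⟨⟨Φ, fun k M hM => ?_⟩, rfl⟩
  let D : ι → CStarMatrix (Fin k) (Fin k) (Matrix (Fin d) (Fin d) ℂ) :=
    fun m => CStarMatrix.ofMatrix (Matrix.diagonal fun _ : Fin k => K m)
  have hconj : ∀ m, 0 ≤ D m * M * star (D m) := fun m => star_right_conjugate_nonneg hM _
  have hentry : ∀ m p q, (D m * M * star (D m)) p q = K m * M p q * (K m)ᴴ := by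
    intro m p q
    have hD : ∀ i j, D m i j = if i = j then K m else 0 := fun i j => Matrix.diagonal_apply ..
    simp [CStarMatrix.mul_apply, CStarMatrix.star_apply, hD, apply_ite star,
      Matrix.star_eq_conjTranspose, mul_assoc]
  have hMap : M.map Φ = ∑ m, D m * M * star (D m) := by
    refine CStarMatrix.ext fun p q => ?_
    have hsum : (∑ m, D m * M * star (D m)) p q = ∑ m, (D m * M * star (D m)) p q :=
      Matrix.sum_apply p q Finset.univ fun m => D m * M * star (D m)
    rw [hsum, CStarMatrix.map_apply, h]
    exact Finset.sum_congr rfl fun m _ => (hentry m p q).symm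
  change 0 ≤ M.map Φ
  rw [hMap]
  exact Finset.sum_nonneg fun m _ => hconj m

-- The nonnegative cone is generated by the elements `y† y`, and flattening the blocks turns each of
-- them into a Gram matrix.
open scoped Matrix.Norms.L2Operator MatrixOrder CStarAlgebra in
lemma posSemidef_of_cstarMatrix_nonneg {k : ℕ}
    {M : CStarMatrix (Fin k) (Fin k) (Matrix (Fin d) (Fin d) ℂ)} (hM : 0 ≤ M) :
    (Matrix.of fun p q : Fin d × Fin k => M p.2 q.2 p.1 q.1).PosSemidef := by
  rw [StarOrderedRing.nonneg_iff] at hM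
  induction hM using AddSubmonoid.closure_induction with
  | mem x hx =>
    obtain ⟨y, rfl⟩ := hx
    convert Matrix.posSemidef_conjTranspose_mul_self
      (Matrix.of fun (p : Fin d × Fin k) (q : Fin d × Fin k) => y p.2 q.2 p.1 q.1)
      using 1
    ext p q
    simp [CStarMatrix.mul_apply, CStarMatrix.star_apply, Matrix.sum_apply, Matrix.mul_apply,
      Matrix.star_eq_conjTranspose, Fintype.sum_prod_type]
    exact Finset.sum_comm
  | zero => exact Matrix.PosSemidef.zero
  | add x y _ _ hx hy => exact hx.add hy

open scoped Matrix.Norms.L2Operator MatrixOrder CStarAlgebra in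
lemma IsCompletelyPositive.posSemidef_choi [NeZero d] {Φ : SuperOp d}
    (h : IsCompletelyPositive Φ) : (choi Φ).PosSemidef := by
  obtain ⟨Ψ, rfl⟩ := h
  -- Only row `0` is nonzero, with entries `E_{0b}`. Thus `Y† Y` is the block matrix of the units
  -- `E_{ab}`, which `Ψ` sends blockwise to the Choi matrix.
  let Y : CStarMatrix (Fin d) (Fin d) (Matrix (Fin d) (Fin d) ℂ) :=
    CStarMatrix.ofMatrix (Matrix.of fun c b => if c = 0 then Matrix.single 0 b 1 else 0)
  have hY : ∀ c b, Y c b = if c = 0 then Matrix.single 0 b 1 else 0 := fun _ _ => rfl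
  have hYY : ∀ a b, (star Y * Y) a b = Matrix.single a b 1 := by
    intro a b
    simp [CStarMatrix.mul_apply, CStarMatrix.star_apply, hY, Matrix.star_eq_conjTranspose]
  convert posSemidef_of_cstarMatrix_nonneg
    (Ψ.map_cstarMatrix_nonneg' d _ (star_mul_self_nonneg Y)) using 1
  ext p q
  simp [choi_apply, CStarMatrix.map_apply, hYY]

lemma IsCompletelyPositive.exists_kraus [NeZero d] {Φ : SuperOp d} (h : IsCompletelyPositive Φ) :
    ∃ K : Fin d × Fin d → Matrix (Fin d) (Fin d) ℂ, ∀ ρ, Φ ρ = ∑ m, K m * ρ * (K m)ᴴ :=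
  exists_kraus_of_posSemidef_choi h.posSemidef_choi

lemma isCompletelyPositive_of_posSemidef_choi {Φ : SuperOp d} (h : (choi Φ).PosSemidef) :
    IsCompletelyPositive Φ :=
  let ⟨K, hK⟩ := exists_kraus_of_posSemidef_choi h
  isCompletelyPositive_of_kraus K hK

end CompletePositivity

/-! ### The defect: distance from complete positivity -/

section Defect

variable {d : ℕ} [NeZero d]

lemma isCompletelyPositive_iff_posSemidef_choi {Φ : SuperOp d} :
    IsCompletelyPositive Φ ↔ (choi Φ).PosSemidef :=
  ⟨fun h => h.posSemidef_choi, isCompletelyPositive_of_posSemidef_choi⟩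

lemma IsCompletelyPositive.add {Φ Ψ : SuperOp d} (hΦ : IsCompletelyPositive Φ)
    (hΨ : IsCompletelyPositive Ψ) : IsCompletelyPositive (Φ + Ψ) := by
  rw [isCompletelyPositive_iff_posSemidef_choi] at *
  rw [map_add]
  exact hΦ.add hΨ

lemma IsCompletelyPositive.smul {Φ : SuperOp d} (hΦ : IsCompletelyPositive Φ) {r : ℝ}
    (hr : 0 ≤ r) : IsCompletelyPositive ((r : ℂ) • Φ) := by
  rw [isCompletelyPositive_iff_posSemidef_choi] at *
  rw [map_smul]
  exact hΦ.smul (by exact_mod_cast hr)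

lemma IsCompletelyPositive.mul {Φ Ψ : SuperOp d} (hΦ : IsCompletelyPositive Φ)
    (hΨ : IsCompletelyPositive Ψ) : IsCompletelyPositive (Φ * Ψ) := by
  obtain ⟨K, hK⟩ := hΦ.exists_kraus
  obtain ⟨M, hM⟩ := hΨ.exists_kraus
  refine isCompletelyPositive_of_kraus (fun p : (Fin d × Fin d) × (Fin d × Fin d) => K p.1 * M p.2)
    fun ρ => ?_
  simp only [Module.End.mul_apply, hM, hK, Fintype.sum_prod_type, Matrix.mul_sum, Matrix.sum_mul,
    Matrix.conjTranspose_mul, mul_assoc]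

lemma IsCompletelyPositive.map_posSemidef {Φ : SuperOp d} (hΦ : IsCompletelyPositive Φ)
    {X : Matrix (Fin d) (Fin d) ℂ} (hX : X.PosSemidef) : (Φ X).PosSemidef := by
  obtain ⟨K, hK⟩ := hΦ.exists_kraus
  rw [hK]
  exact Matrix.posSemidef_sum _ fun m _ => hX.mul_mul_conjTranspose_same (K m)

lemma IsCompletelyPositive.map_conjTranspose {Φ : SuperOp d} (hΦ : IsCompletelyPositive Φ)
    (X : Matrix (Fin d) (Fin d) ℂ) : Φ Xᴴ = (Φ X)ᴴ := by
  obtain ⟨K, hK⟩ := hΦ.exists_kraus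
  simp [hK, Matrix.conjTranspose_sum, Matrix.conjTranspose_mul, mul_assoc]

omit [NeZero d] in
lemma isHermitian_choi {Φ : SuperOp d} (hΦ : ∀ X, Φ Xᴴ = (Φ X)ᴴ) : (choi Φ).IsHermitian := by
  ext p q
  rw [Matrix.conjTranspose_apply, choi_apply, choi_apply, ← Matrix.conjTranspose_apply, ← hΦ]
  simp

omit [NeZero d] in
lemma trace_choi (Φ : SuperOp d) : (choi Φ).trace = (Φ 1).trace := by
  have h1 : (1 : Matrix (Fin d) (Fin d) ℂ) = ∑ a, Matrix.single a a 1 := by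
    ext i j; simp [Matrix.sum_apply, Matrix.single_apply, Matrix.one_apply, ite_and]
  rw [h1, map_sum, Matrix.trace_sum]
  simp only [Matrix.trace, Matrix.diag, choi_apply, Fintype.sum_prod_type]
  exact Finset.sum_comm

/-- The map `ρ ↦ tr ρ • 𝕀`, whose Choi matrix is the identity. -/
def traceMap (d : ℕ) : SuperOp d := (Matrix.traceLinearMap (Fin d) ℂ ℂ).smulRight 1

omit [NeZero d] in
lemma choi_traceMap : choi (traceMap d) = 1 := by
  ext p q
  simp only [choi_apply, traceMap, LinearMap.smulRight_apply, Matrix.traceLinearMap_apply,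
    Matrix.smul_apply, Matrix.one_apply, Prod.ext_iff]
  by_cases h : p.2 = q.2
  · simp [h]
  · simp [h, Matrix.trace_single_eq_of_ne]

/-- Cauchy–Schwarz in each row of a Gram factor. Applied to Choi matrices, it shows that a map of
small weight perturbs the quadratic form only slightly. -/
lemma dotProduct_mulVec_le_trace_mul {n : Type*} [Fintype n] {A : Matrix n n ℂ}
    (hA : A.PosSemidef) (x : n → ℂ) :
    (star x ⬝ᵥ (A *ᵥ x)).re ≤ A.trace.re * ∑ i, ‖x i‖ ^ 2 := by
  obtain ⟨B, rfl⟩ := exists_eq_conjTranspose_mul_self hA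
  have h1 : (star x ⬝ᵥ ((Bᴴ * B) *ᵥ x)).re = ∑ i, ‖(B *ᵥ x) i‖ ^ 2 := by
    rw [← Matrix.mulVec_mulVec, Matrix.dotProduct_mulVec, ← Matrix.star_mulVec]
    simp [dotProduct, Complex.conj_mul', ← Complex.ofReal_pow]
  have h2 : (Bᴴ * B).trace.re = ∑ i, ∑ j, ‖B i j‖ ^ 2 := by
    simp [Matrix.trace, Matrix.mul_apply, Complex.conj_mul', ← Complex.ofReal_pow]
    exact Finset.sum_comm
  rw [h1, h2, Finset.sum_mul]
  refine Finset.sum_le_sum fun i _ => ?_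
  calc ‖(B *ᵥ x) i‖ ^ 2 ≤ (∑ j, ‖B i j‖ * ‖x j‖) ^ 2 := by
        gcongr
        exact (norm_sum_le _ _).trans_eq (by simp)
    _ ≤ _ := Finset.sum_mul_sq_le_sq_mul_sq _ _ _

open scoped Matrix.Norms.L2Operator MatrixOrder in
lemma posSemidef_norm_smul_one_add {n : Type*} [Fintype n] [DecidableEq n] {A : Matrix n n ℂ}
    (hA : A.IsHermitian) : ((‖A‖ : ℂ) • (1 : Matrix n n ℂ) + A).PosSemidef := by
  have h := IsSelfAdjoint.neg_algebraMap_norm_le_self (a := A) hA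
  rw [Matrix.le_iff] at h
  have hA' : A - -(algebraMap ℝ (Matrix n n ℂ)) ‖A‖ = (‖A‖ : ℂ) • (1 : Matrix n n ℂ) + A := by
    rw [Algebra.algebraMap_eq_smul_one, sub_neg_eq_add, add_comm]
    simp
  rw [← hA']
  exact h

/-- The set of weights `tr N(𝕀)` of the completely positive maps `N` that make `Φ + N` completely
positive. -/
def defectSet (Φ : SuperOp d) : Set ℝ :=
  {r | ∃ N : SuperOp d, IsCompletelyPositive N ∧ IsCompletelyPositive (Φ + N) ∧
    (N 1).trace.re = r}

/-- The least weight of a completely positive map that has to be added to `Φ` to make it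
completely positive. -/
noncomputable def defect (Φ : SuperOp d) : ℝ := sInf (defectSet Φ)

lemma IsCompletelyPositive.trace_one_nonneg {N : SuperOp d} (h : IsCompletelyPositive N) :
    0 ≤ (N 1).trace.re :=
  (Complex.le_def.mp (h.map_posSemidef Matrix.PosSemidef.one).trace_nonneg).1

lemma bddBelow_defectSet (Φ : SuperOp d) : BddBelow (defectSet Φ) :=
  ⟨0, fun _ ⟨_, hN, _, hr⟩ => hr ▸ hN.trace_one_nonneg⟩

lemma isCompletelyPositive_traceMap : IsCompletelyPositive (traceMap d) := by
  rw [isCompletelyPositive_iff_posSemidef_choi, choi_traceMap]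
  exact Matrix.PosSemidef.one

open scoped Matrix.Norms.L2Operator

lemma isCompletelyPositive_add_traceMap {Φ : SuperOp d} (h : (choi Φ).IsHermitian) :
    IsCompletelyPositive (Φ + (‖choi Φ‖ : ℂ) • traceMap d) := by
  rw [isCompletelyPositive_iff_posSemidef_choi, map_add, map_smul, choi_traceMap, add_comm]
  exact posSemidef_norm_smul_one_add h

omit [NeZero d] in
lemma trace_smul_traceMap_one (r : ℝ) :
    (((r : ℂ) • traceMap d) 1).trace.re = d ^ 2 * r := by
  simp [traceMap, ← Complex.ofReal_natCast]
  ring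

lemma defectSet_nonempty {Φ : SuperOp d} (h : (choi Φ).IsHermitian) : (defectSet Φ).Nonempty :=
  ⟨_, _, isCompletelyPositive_traceMap.smul (norm_nonneg _),
    isCompletelyPositive_add_traceMap h, rfl⟩

lemma IsCompletelyPositive.defect_le_zero {Φ : SuperOp d} (h : IsCompletelyPositive Φ) :
    defect Φ ≤ 0 := by
  refine csInf_le (bddBelow_defectSet Φ) ⟨0, ?_, by simpa using h, by simp⟩
  rw [isCompletelyPositive_iff_posSemidef_choi, map_zero]
  exact Matrix.PosSemidef.zero

/-- No minimiser is needed: corrections `N` of arbitrarily small weight bound the form of `choi Φ`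
below by `-ε` for every `ε > 0`. -/
lemma isCompletelyPositive_of_defect_le_zero {Φ : SuperOp d} (h : (choi Φ).IsHermitian)
    (h0 : defect Φ ≤ 0) : IsCompletelyPositive Φ := by
  rw [isCompletelyPositive_iff_posSemidef_choi]
  refine .of_dotProduct_mulVec_nonneg h fun x => ?_
  rw [Complex.le_def]
  refine ⟨?_, (h.im_star_dotProduct_mulVec_self x).symm⟩
  set S := ∑ i, ‖x i‖ ^ 2
  have hS : 0 ≤ S := Finset.sum_nonneg fun _ _ => by positivity
  refine le_of_forall_pos_lt_add fun ε hε => ?_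
  obtain ⟨_, ⟨N, hN, hΦN, rfl⟩, hr⟩ := exists_lt_of_csInf_lt (defectSet_nonempty h)
    (h0.trans_lt (show 0 < ε / (S + 1) by positivity))
  have h1 := dotProduct_mulVec_le_trace_mul hN.posSemidef_choi x
  have h2 := (Complex.le_def.mp (hΦN.posSemidef_choi.dotProduct_mulVec_nonneg x)).1
  rw [map_add, Matrix.add_mulVec, dotProduct_add, Complex.add_re] at h2
  rw [trace_choi] at h1
  have h3 : (N 1).trace.re * S < ε := by
    have := hN.trace_one_nonneg
    rw [lt_div_iff₀ (by positivity)] at hr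
    nlinarith
  simp only [Complex.zero_re] at h2 ⊢
  linarith

/-- Adding `‖choi Ψ‖ • traceMap d` makes `Ψ` completely positive; the factor `d ^ 2` is the weight
of `traceMap d`. -/
lemma defect_add_le {Φ Ψ : SuperOp d} (hΦ : (choi Φ).IsHermitian) (hΨ : (choi Ψ).IsHermitian) :
    defect (Φ + Ψ) ≤ defect Φ + d ^ 2 * ‖choi Ψ‖ := by
  rw [← sub_le_iff_le_add]
  refine le_csInf (defectSet_nonempty hΦ) ?_
  rintro _ ⟨N, hN, hΦN, rfl⟩
  rw [sub_le_iff_le_add]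
  refine csInf_le (bddBelow_defectSet _) ⟨N + (‖choi Ψ‖ : ℂ) • traceMap d,
    hN.add (isCompletelyPositive_traceMap.smul (norm_nonneg _)), ?_, ?_⟩
  · rw [add_add_add_comm]
    exact hΦN.add (isCompletelyPositive_add_traceMap hΨ)
  · rw [LinearMap.add_apply, Matrix.trace_add, Complex.add_re, trace_smul_traceMap_one]

-- A correction `N` for `Φ` gives the correction `Ψ * N` for `Ψ * Φ`.
open scoped Pointwise in
lemma defect_mul_le {Φ Ψ : SuperOp d} (hΦ : (choi Φ).IsHermitian) (hΨ : IsCompletelyPositive Ψ)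
    {k : ℝ} (hk : 0 ≤ k)
    (htr : ∀ X : Matrix (Fin d) (Fin d) ℂ, X.PosSemidef → (Ψ X).trace.re ≤ k * X.trace.re) :
    defect (Ψ * Φ) ≤ k * defect Φ := by
  have hne := defectSet_nonempty hΦ
  have hsmul : k * defect Φ = sInf (k • defectSet Φ) := by
    rw [Real.sInf_smul_of_nonneg hk, smul_eq_mul, defect]
  rw [hsmul]
  refine le_csInf (hne.smul_set) ?_
  rintro _ ⟨_, ⟨N, hN, hΦN, rfl⟩, rfl⟩
  refine (csInf_le (bddBelow_defectSet _) ⟨Ψ * N, hΨ.mul hN, ?_, rfl⟩).trans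
    (htr _ (hN.map_posSemidef .one))
  rw [← mul_add]
  exact hΨ.mul hΦN

lemma abs_defect_sub_le {Φ Ψ : SuperOp d} (hΦ : (choi Φ).IsHermitian)
    (hΨ : (choi Ψ).IsHermitian) :
    |defect Φ - defect Ψ| ≤ d ^ 2 * ‖choi Φ - choi Ψ‖ := by
  have h1 := defect_add_le hΨ (Ψ := Φ - Ψ) (by rw [map_sub]; exact hΦ.sub hΨ)
  have h2 := defect_add_le hΦ (Ψ := Ψ - Φ) (by rw [map_sub]; exact hΨ.sub hΦ)
  rw [add_sub_cancel, map_sub] at h1 h2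
  rw [norm_sub_rev] at h2
  rw [abs_le]
  constructor <;> linarith

lemma continuousOn_defect {Φ : ℝ → SuperOp d} {s : Set ℝ}
    (hΦ : ∀ u ∈ s, (choi (Φ u)).IsHermitian) (hc : ContinuousOn (fun u => choi (Φ u)) s) :
    ContinuousOn (fun u => defect (Φ u)) s := by
  intro u hu
  have h1 : Filter.Tendsto (fun v => (d : ℝ) ^ 2 * ‖choi (Φ v) - choi (Φ u)‖)
      (nhdsWithin u s) (nhds 0) := by
    have := ((hc u hu).sub_const (choi (Φ u))).norm.const_mul ((d : ℝ) ^ 2)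
    simpa using this
  rw [ContinuousWithinAt, tendsto_iff_dist_tendsto_zero]
  refine squeeze_zero' (Filter.Eventually.of_forall fun _ => dist_nonneg) ?_ h1
  filter_upwards [self_mem_nhdsWithin] with v hv
  exact abs_defect_sub_le (hΦ v hv) (hΦ u hu)

end Defect

/-! ### Complete positivity along GKSL flows -/

section Flow

variable {d : ℕ} [NeZero d]

/-- The superoperator `ρ ↦ A ρ A†`. -/
def conjMap (A : Matrix (Fin d) (Fin d) ℂ) : SuperOp d :=
  LinearMap.mulLeft ℂ A * LinearMap.mulRight ℂ Aᴴ

omit [NeZero d] in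
lemma conjMap_apply (A ρ : Matrix (Fin d) (Fin d) ℂ) : conjMap A ρ = A * ρ * Aᴴ := by
  simp [conjMap, mul_assoc]

omit [NeZero d] in
lemma isCompletelyPositive_conjMap (A : Matrix (Fin d) (Fin d) ℂ) :
    IsCompletelyPositive (conjMap A) :=
  isCompletelyPositive_of_kraus (fun _ : Unit => A) fun ρ => by simp [conjMap_apply]

omit [NeZero d] in
lemma map_conjTranspose_of_isHermitian_choi {Φ : SuperOp d} (h : (choi Φ).IsHermitian)
    (X : Matrix (Fin d) (Fin d) ℂ) : Φ Xᴴ = (Φ X)ᴴ := by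
  ext i j
  rw [Matrix.conjTranspose_apply, superOp_apply_eq_sum_choi, superOp_apply_eq_sum_choi, star_sum,
    Finset.sum_comm]
  refine Finset.sum_congr rfl fun a _ => ?_
  rw [star_sum]
  refine Finset.sum_congr rfl fun b _ => ?_
  rw [star_mul', h.apply, Matrix.conjTranspose_apply]

-- Absorbing the anticommutator into `G = -i H - 1/2 ∑ V† V` leaves a completely positive remainder,
-- the form in which an Euler step can be completed to a square.
omit [NeZero d] in
lemma IsGKSL.exists_drift {L : SuperOp d} (hL : IsGKSL L) :
    ∃ (G : Matrix (Fin d) (Fin d) ℂ) (m : ℕ) (V : Fin m → Matrix (Fin d) (Fin d) ℂ),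
      (∀ ρ, L ρ = G * ρ + ρ * Gᴴ + ∑ α, V α * ρ * (V α)ᴴ) ∧ ∀ ρ, (L ρ).trace = 0 := by
  obtain ⟨H, m, V, hH, hV⟩ := hL
  refine ⟨-(Complex.I • H) - (1 / 2 : ℂ) • ∑ α, (V α)ᴴ * V α, m, V, fun ρ => ?_, fun ρ => ?_⟩
  · rw [hV]
    have hsum : ∑ α, (⁅V α, ρ * (V α)ᴴ⁆ + ⁅V α * ρ, (V α)ᴴ⁆) =
        (2 : ℂ) • ∑ α, V α * ρ * (V α)ᴴ - (∑ α, (V α)ᴴ * V α) * ρ -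
          ρ * ∑ α, (V α)ᴴ * V α := by
      rw [Finset.sum_mul, Finset.mul_sum, Finset.smul_sum, ← Finset.sum_sub_distrib,
        ← Finset.sum_sub_distrib]
      refine Finset.sum_congr rfl fun α _ => ?_
      simp only [Ring.lie_def, two_smul, mul_assoc]
      abel
    have hS : (∑ α, (V α)ᴴ * V α)ᴴ = ∑ α, (V α)ᴴ * V α := by
      simp [Matrix.conjTranspose_sum]
    rw [hsum]
    simp only [Matrix.conjTranspose_sub, Matrix.conjTranspose_neg, Matrix.conjTranspose_smul, hS,
      hH.eq, Ring.lie_def, sub_mul, mul_sub, neg_mul, mul_neg, smul_mul_assoc, mul_smul_comm]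
    simp only [one_div, star_inv₀, star_ofNat, RCLike.star_def, Complex.conj_I]
    module
  · have hlie : ∀ A B : Matrix (Fin d) (Fin d) ℂ, ⁅A, B⁆.trace = 0 := fun A B => by
      rw [Ring.lie_def, Matrix.trace_sub, Matrix.trace_mul_comm, sub_self]
    simp [hV, Matrix.trace_add, hlie]

omit [NeZero d] in
open scoped Matrix.Norms.L2Operator in
lemma trace_conjMap_le (G : Matrix (Fin d) (Fin d) ℂ) {X : Matrix (Fin d) (Fin d) ℂ}
    (hX : X.PosSemidef) : (conjMap G X).trace.re ≤ ‖Gᴴ * G‖ * X.trace.re := by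
  obtain ⟨B, rfl⟩ := exists_eq_conjTranspose_mul_self hX
  have h1 := posSemidef_norm_smul_one_add (A := -(Gᴴ * G))
    (Matrix.isHermitian_conjTranspose_mul_self G).neg
  have h2 := (Complex.le_def.mp (h1.mul_mul_conjTranspose_same B).trace_nonneg).1
  rw [norm_neg] at h2
  have h3 : (B * ((‖Gᴴ * G‖ : ℂ) • 1 + -(Gᴴ * G)) * Bᴴ).trace =
      (‖Gᴴ * G‖ : ℂ) * (Bᴴ * B).trace - (conjMap G (Bᴴ * B)).trace := by
    rw [conjMap_apply, mul_add, add_mul, Matrix.trace_add, mul_neg, neg_mul, Matrix.trace_neg,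
      mul_smul_comm, smul_mul_assoc, mul_one, Matrix.trace_smul, Matrix.trace_mul_comm B Bᴴ,
      smul_eq_mul, ← sub_eq_add_neg]
    have h4 : G * (Bᴴ * B) * Gᴴ = (G * Bᴴ) * (B * Gᴴ) := by simp only [mul_assoc]
    rw [h4, Matrix.trace_mul_comm (G * Bᴴ)]
    simp only [mul_assoc]
  rw [h3] at h2
  simp at h2
  linarith

open scoped Matrix.Norms.L2Operator in
/-- An Euler step with a GKSL generator is completely positive up to a second-order term. -/
lemma IsGKSL.exists_step {L : SuperOp d} (hL : IsGKSL L) :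
    ∃ (G : Matrix (Fin d) (Fin d) ℂ), ∀ h : ℝ, 0 ≤ h →
      IsCompletelyPositive (1 + (h : ℂ) • L + ((h ^ 2 : ℝ) : ℂ) • conjMap G) ∧
      ∀ X : Matrix (Fin d) (Fin d) ℂ, X.PosSemidef →
        ((1 + (h : ℂ) • L + ((h ^ 2 : ℝ) : ℂ) • conjMap G) X).trace.re ≤
          (1 + h ^ 2 * ‖Gᴴ * G‖) * X.trace.re := by
  obtain ⟨G, m, V, hV, htr⟩ := hL.exists_drift
  refine ⟨G, fun h hh => ⟨?_, fun X hX => ?_⟩⟩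
  -- Completing the square: `(1 + h G) ρ (1 + h G)†` contains the drift to first order and exceeds
  -- it by `h² G ρ G†`.
  · have hstep : 1 + (h : ℂ) • L + ((h ^ 2 : ℝ) : ℂ) • conjMap G =
        conjMap (1 + (h : ℂ) • G) + (h : ℂ) • ∑ α, conjMap (V α) := by
      refine LinearMap.ext fun ρ => ?_
      simp only [LinearMap.add_apply, LinearMap.smul_apply, LinearMap.sum_apply, conjMap_apply, hV,
        Module.End.one_apply, Matrix.conjTranspose_add, Matrix.conjTranspose_smul,
        Matrix.conjTranspose_one, RCLike.star_def, Complex.conj_ofReal, add_mul, mul_add, one_mul,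
        mul_one, smul_mul_assoc, mul_smul_comm, smul_add, smul_smul]
      push_cast
      module
    rw [hstep]
    refine (isCompletelyPositive_conjMap _).add (IsCompletelyPositive.smul ?_ hh)
    exact isCompletelyPositive_of_kraus V fun ρ => by simp [conjMap_apply]
  -- The first-order term has trace zero, so only the `h²` term changes the trace.
  · have h1 := trace_conjMap_le G hX
    simp only [LinearMap.add_apply, LinearMap.smul_apply, Module.End.one_apply, Matrix.trace_add,
      Matrix.trace_smul, htr, Complex.add_re, smul_eq_mul,
      Complex.re_ofReal_mul, Complex.zero_re]
    nlinarith [mul_le_mul_of_nonneg_left h1 (sq_nonneg h)]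

open scoped Matrix.Norms.L2Operator Topology in
/-- Complete positivity is preserved along a differentiable path whose right derivatives are
given by GKSL generators. No regularity of the generators in time is needed. -/
theorem isCompletelyPositive_of_hasDerivWithinAt {s t : ℝ} (hst : s ≤ t) {Φ L : ℝ → SuperOp d}
    (hL : ∀ u ∈ Ico s t, IsGKSL (L u))
    (hcont : ContinuousOn (fun u => choi (Φ u)) (Icc s t))
    (hderiv : ∀ u ∈ Ico s t,
      HasDerivWithinAt (fun v => choi (Φ v)) (choi (L u * Φ u)) (Ici u) u)
    (hherm : ∀ u ∈ Icc s t, (choi (Φ u)).IsHermitian) (hs : IsCompletelyPositive (Φ s)) :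
    IsCompletelyPositive (Φ t) := by
  refine isCompletelyPositive_of_defect_le_zero (hherm t ⟨hst, le_rfl⟩) ?_
  refine image_le_of_liminf_slope_right_le_deriv_boundary (f := fun u => defect (Φ u))
    (B := fun _ => 0) (B' := fun _ => 0) (continuousOn_defect hherm hcont) hs.defect_le_zero
    continuousOn_const (fun u _ => hasDerivWithinAt_const _ _ _) (fun u hu r hr => ?_)
    ⟨hst, le_rfl⟩
  obtain ⟨G, hG⟩ := (hL u hu).exists_step
  have huH := hherm u ⟨hu.1, hu.2.le⟩
  have hslope : Filter.Tendsto (slope (fun v => choi (Φ v)) u) (𝓝[>] u)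
      (𝓝 (choi (L u * Φ u))) := by
    have := hasDerivWithinAt_iff_tendsto_slope.mp (hderiv u hu)
    rwa [Ici_sdiff_left] at this
  have hid : Filter.Tendsto (fun z : ℝ => z - u) (𝓝[>] u) (𝓝 0) := by
    have : Filter.Tendsto (fun z : ℝ => z - u) (𝓝 u) (𝓝 (u - u)) :=
      (continuous_id.sub continuous_const).tendsto u
    rw [sub_self] at this
    exact this.mono_left nhdsWithin_le_nhds
  -- This is the upper bound for the slope of the defect: the first term comes from the trace growth
  -- of the Euler step `Ψ`, the second from the error `Φ z - Ψ * Φ u`.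
  have hbound : Filter.Tendsto (fun z : ℝ => (z - u) * ‖Gᴴ * G‖ * defect (Φ u) +
      d ^ 2 * ‖slope (fun v => choi (Φ v)) u z - choi (L u * Φ u) -
        (z - u) • choi (conjMap G * Φ u)‖) (𝓝[>] u) (𝓝 0) := by
    have h1 := ((hslope.sub_const (choi (L u * Φ u))).sub
      (hid.smul_const (choi (conjMap G * Φ u)))).norm.const_mul ((d : ℝ) ^ 2)
    have h2 := (hid.mul_const ‖Gᴴ * G‖).mul_const (defect (Φ u))
    simpa using h2.add h1
  refine Filter.Eventually.frequently ?_
  filter_upwards [hbound.eventually_lt_const hr, self_mem_nhdsWithin,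
    Ioc_mem_nhdsGT hu.2] with z hz hzu hzt
  refine lt_of_le_of_lt ?_ hz
  have hpos : 0 < z - u := sub_pos.mpr hzu
  obtain ⟨hcp, htr⟩ := hG (z - u) hpos.le
  set Ψ := 1 + ((z - u : ℝ) : ℂ) • L u + (((z - u) ^ 2 : ℝ) : ℂ) • conjMap G with hΨ
  have hΨH : (choi (Ψ * Φ u)).IsHermitian := isHermitian_choi fun X => by
    rw [Module.End.mul_apply, map_conjTranspose_of_isHermitian_choi huH, hcp.map_conjTranspose,
      Module.End.mul_apply]
  have hzH := hherm z ⟨hu.1.trans hzt.1.le, hzt.2⟩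
  have h1 := defect_add_le hΨH (Ψ := Φ z - Ψ * Φ u) (by rw [map_sub]; exact hzH.sub hΨH)
  have h2 := defect_mul_le huH hcp (by positivity) htr
  have h3 : choi (Φ z - Ψ * Φ u) = (z - u) • (slope (fun v => choi (Φ v)) u z -
      choi (L u * Φ u) - (z - u) • choi (conjMap G * Φ u)) := by
    rw [smul_sub, smul_sub, slope, smul_inv_smul₀ hpos.ne', hΨ]
    simp only [add_mul, one_mul, smul_mul_assoc, map_sub, map_add, map_smul, vsub_eq_sub, smul_smul,
      Complex.coe_smul]
    rw [sq]
    abel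
  rw [add_sub_cancel, h3, norm_smul, Real.norm_of_nonneg hpos.le] at h1
  rw [slope_def_field, div_le_iff₀ hpos]
  nlinarith

end Flow

/-! ### Canonical forms of the generator -/

section CanonicalForm

variable {d : ℕ}

/-- The dissipator `V ρ V† - 1/2 {V† V, ρ}` of a noise operator `V`. -/
noncomputable def dissipator (V ρ : Matrix (Fin d) (Fin d) ℂ) : Matrix (Fin d) (Fin d) ℂ :=
  V * ρ * Vᴴ - (1 / 2 : ℂ) • (Vᴴ * V * ρ + ρ * (Vᴴ * V))

lemma half_smul_lie_add_lie (V ρ : Matrix (Fin d) (Fin d) ℂ) :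
    (1 / 2 : ℂ) • (⁅V, ρ * Vᴴ⁆ + ⁅V * ρ, Vᴴ⁆) = dissipator V ρ := by
  simp only [dissipator, Ring.lie_def, mul_assoc]
  module

lemma isGKSL_of_dissipator {L : SuperOp d} {ι : Type*} [Fintype ι]
    {H : Matrix (Fin d) (Fin d) ℂ} (hH : H.IsHermitian) (K : ι → Matrix (Fin d) (Fin d) ℂ)
    (hL : ∀ ρ, L ρ = -(Complex.I • ⁅H, ρ⁆) + ∑ m, dissipator (K m) ρ) : IsGKSL L := by
  refine ⟨H, Fintype.card ι, K ∘ (Fintype.equivFin ι).symm, hH, fun ρ => ?_⟩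
  rw [hL, Finset.smul_sum]
  simp only [half_smul_lie_add_lie]
  congr 1
  exact (Equiv.sum_comp (Fintype.equivFin ι).symm fun m => dissipator (K m) ρ).symm

lemma sum_dissipator_eq {ι κ : Type*} [Fintype ι] [Fintype κ]
    (F : κ → Matrix (Fin d) (Fin d) ℂ) (c : ι → κ → ℂ) (ρ : Matrix (Fin d) (Fin d) ℂ) :
    ∑ m, dissipator (∑ k, c m k • F k) ρ =
      ∑ k, ∑ l, (∑ m, c m k * star (c m l)) •
        (F k * ρ * (F l)ᴴ - (1 / 2 : ℂ) • ((F l)ᴴ * F k * ρ + ρ * ((F l)ᴴ * F k))) := by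
  have h : ∀ m, dissipator (∑ k, c m k • F k) ρ = ∑ k, ∑ l, (c m k * star (c m l)) •
      (F k * ρ * (F l)ᴴ - (1 / 2 : ℂ) • ((F l)ᴴ * F k * ρ + ρ * ((F l)ᴴ * F k))) := by
    intro m
    have h1 : (∑ k, c m k • F k) * ρ * (∑ k, c m k • F k)ᴴ =
        ∑ k, ∑ l, (c m k * star (c m l)) • (F k * ρ * (F l)ᴴ) := by
      simp only [Matrix.conjTranspose_sum, Matrix.conjTranspose_smul, Finset.sum_mul,
        Finset.mul_sum, smul_mul_assoc, mul_smul_comm, Finset.smul_sum, smul_smul]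
      rw [Finset.sum_comm]
      simp only [mul_comm (c m _)]
    have h2 : (∑ k, c m k • F k)ᴴ * (∑ k, c m k • F k) =
        ∑ k, ∑ l, (c m k * star (c m l)) • ((F l)ᴴ * F k) := by
      simp only [Matrix.conjTranspose_sum, Matrix.conjTranspose_smul, Finset.sum_mul,
        Finset.mul_sum, smul_mul_assoc, mul_smul_comm, Finset.smul_sum, smul_smul]
    rw [dissipator, h1, h2]
    simp only [Finset.sum_mul, Finset.mul_sum, smul_mul_assoc, mul_smul_comm, smul_sub, smul_add,
      Finset.smul_sum, Finset.sum_sub_distrib, Finset.sum_add_distrib, smul_comm (1 / 2 : ℂ)]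
  simp only [h, Finset.sum_smul]
  rw [Finset.sum_comm]
  exact Finset.sum_congr rfl fun k _ => Finset.sum_comm

lemma IsGKSLWith.isGKSL [NeZero d] {F : Fin (d ^ 2) → Matrix (Fin d) (Fin d) ℂ} {L : SuperOp d}
    (h : IsGKSLWith F L) : IsGKSL L := by
  obtain ⟨H, a, hH, ha, hL⟩ := h
  obtain ⟨B, rfl⟩ := exists_eq_conjTranspose_mul_self ha
  -- The conjugate is needed because `(B† B)_{kl} = ∑ star (B m k) * B m l`.
  refine isGKSL_of_dissipator hH (fun m => ∑ k : {k : Fin (d ^ 2) // k ≠ 0}, star (B m k) • F k)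
    fun ρ => ?_
  have h := sum_dissipator_eq (fun k : {k : Fin (d ^ 2) // k ≠ 0} => F k)
    (fun m k => star (B m k)) ρ
  rw [hL, h]
  simp only [star_star, Matrix.mul_apply, Matrix.conjTranspose_apply]

/-- Orthonormality says `U U† = 1` for the matrix `U` of conjugated entries of the `F α`; as `U` is
square, `U† U = 1`, which is completeness. -/
lemma IsOperatorBasis.sum_trace_smul [NeZero d] {F : Fin (d ^ 2) → Matrix (Fin d) (Fin d) ℂ}
    (hF : IsOperatorBasis F) (X : Matrix (Fin d) (Fin d) ℂ) :
    ∑ α, ((F α)ᴴ * X).trace • F α = X := by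
  have hcard : Fintype.card (Fin (d ^ 2)) = Fintype.card (Fin d × Fin d) := by simp [sq]
  let U : Matrix (Fin (d ^ 2)) (Fin d × Fin d) ℂ := Matrix.of fun α p => star (F α p.1 p.2)
  have hU : U * Uᴴ = 1 := by
    ext α β
    rw [Matrix.one_apply, ← hF.orthonormal α β]
    simp [U, Matrix.mul_apply, Matrix.trace, Fintype.sum_prod_type]
    exact Finset.sum_comm
  rw [Matrix.mul_eq_one_comm_of_equiv (Fintype.equivOfCardEq hcard)] at hU
  ext i j
  have h : ∀ p q : Fin d × Fin d, ∑ α, F α p.1 p.2 * star (F α q.1 q.2) = if p = q then 1 else 0 := by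
    intro p q
    have := congrFun (congrFun hU p) q
    rw [Matrix.one_apply] at this
    simpa [U, Matrix.mul_apply] using this
  calc (∑ α, ((F α)ᴴ * X).trace • F α) i j
      = ∑ α, ∑ q : Fin d × Fin d, X q.1 q.2 * (F α i j * star (F α q.1 q.2)) := by
        simp only [Matrix.sum_apply, Matrix.smul_apply, Matrix.trace, Matrix.diag, Matrix.mul_apply,
          Matrix.conjTranspose_apply, smul_eq_mul, Finset.sum_mul, Fintype.sum_prod_type]
        refine Finset.sum_congr rfl fun α _ => ?_
        rw [Finset.sum_comm]
        exact Finset.sum_congr rfl fun a _ => Finset.sum_congr rfl fun b _ => by ring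
    _ = X i j := by
        rw [Finset.sum_comm]
        simp only [← Finset.mul_sum, h (i, j)]
        simp

lemma IsOperatorBasis.sum_trace_smul_of_trace_eq_zero [NeZero d]
    {F : Fin (d ^ 2) → Matrix (Fin d) (Fin d) ℂ} (hF : IsOperatorBasis F)
    {X : Matrix (Fin d) (Fin d) ℂ} (hX : X.trace = 0) :
    ∑ k : {k : Fin (d ^ 2) // k ≠ 0}, ((F k)ᴴ * X).trace • F k = X := by
  conv_rhs => rw [← hF.sum_trace_smul X]
  have h0 : ((F 0)ᴴ * X).trace = 0 := by
    rw [hF.zero_eq]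
    simp [hX]
  rw [Fintype.sum_eq_add_sum_subtype_ne (fun α => ((F α)ᴴ * X).trace • F α) 0, h0, zero_smul,
    zero_add]

lemma IsOperatorBasis.isGKSLWith [NeZero d] {F : Fin (d ^ 2) → Matrix (Fin d) (Fin d) ℂ}
    (hF : IsOperatorBasis F) {L : SuperOp d} {ι : Type*} [Fintype ι]
    {H : Matrix (Fin d) (Fin d) ℂ} (hH : H.IsHermitian) {K : ι → Matrix (Fin d) (Fin d) ℂ}
    (hK : ∀ m, (K m).trace = 0)
    (hL : ∀ ρ, L ρ = -(Complex.I • ⁅H, ρ⁆) + ∑ m, dissipator (K m) ρ) : IsGKSLWith F L := by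
  let D : Matrix ι {k : Fin (d ^ 2) // k ≠ 0} ℂ := Matrix.of fun m k => star ((F k)ᴴ * K m).trace
  refine ⟨H, Dᴴ * D, hH, Matrix.posSemidef_conjTranspose_mul_self D, fun ρ => ?_⟩
  rw [hL]
  congr 1
  have h := sum_dissipator_eq (fun k : {k : Fin (d ^ 2) // k ≠ 0} => F k)
    (fun m k => ((F k)ᴴ * K m).trace) ρ
  simp only [hF.sum_trace_smul_of_trace_eq_zero (hK _)] at h
  rw [h]
  simp only [D, Matrix.mul_apply, Matrix.conjTranspose_apply, Matrix.of_apply, star_star]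

/-- The vectorisation of the identity matrix. -/
def vecOne (d : ℕ) (p : Fin d × Fin d) : ℂ := if p.1 = p.2 then 1 else 0

lemma star_vecOne : star (vecOne d) = vecOne d := by
  ext p
  simp [vecOne, apply_ite]

lemma choi_one : choi (1 : SuperOp d) = vecMulVec (vecOne d) (vecOne d) := by
  ext p q
  simp [choi_apply, vecMulVec_apply, vecOne, Matrix.single_apply, eq_comm, ite_and]
  split_ifs <;> rfl

lemma vecOne_dotProduct_self : vecOne d ⬝ᵥ vecOne d = d := by
  simp [dotProduct, vecOne, Fintype.sum_prod_type]

lemma choi_mulLeft (X : Matrix (Fin d) (Fin d) ℂ) (p q : Fin d × Fin d) :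
    choi (LinearMap.mulLeft ℂ X) p q = X p.1 p.2 * vecOne d q := by
  simp only [choi_apply, LinearMap.mulLeft_apply, vecOne]
  have := mul_single_mul_conjTranspose_apply X 1 p.1 q.1 p.2 q.2
  simpa [Matrix.one_apply] using this

lemma choi_mulRight (X : Matrix (Fin d) (Fin d) ℂ) (p q : Fin d × Fin d) :
    choi (LinearMap.mulRight ℂ Xᴴ) p q = vecOne d p * star (X q.1 q.2) := by
  simp only [choi_apply, LinearMap.mulRight_apply, vecOne]
  have := mul_single_mul_conjTranspose_apply 1 X p.1 q.1 p.2 q.2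
  simpa [Matrix.one_apply] using this

/-- A superoperator whose Choi matrix is Hermitian and positive on the orthogonal complement of
the vectorised identity is `ρ ↦ X ρ + ρ X† + ∑ K ρ K†` with traceless `K`. -/
lemma exists_traceless_kraus [NeZero d] {L : SuperOp d} (hherm : (choi L).IsHermitian)
    (hpos : ∀ x : Fin d × Fin d → ℂ, vecOne d ⬝ᵥ x = 0 → 0 ≤ star x ⬝ᵥ (choi L *ᵥ x)) :
    ∃ (X : Matrix (Fin d) (Fin d) ℂ) (K : Fin d × Fin d → Matrix (Fin d) (Fin d) ℂ),
      (∀ m, (K m).trace = 0) ∧ ∀ ρ, L ρ = X * ρ + ρ * Xᴴ + ∑ m, K m * ρ * (K m)ᴴ := by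
  have hd : (d : ℂ) ≠ 0 := Nat.cast_ne_zero.mpr (NeZero.ne d)
  set M := choi L
  let W : Matrix (Fin d × Fin d) (Fin d × Fin d) ℂ := vecMulVec (vecOne d) (vecOne d)
  -- Orthogonal projection onto the complement of `vecOne d`, whose squared norm is `d`.
  let P : Matrix (Fin d × Fin d) (Fin d × Fin d) ℂ := 1 - (d : ℂ)⁻¹ • W
  have hWH : Wᴴ = W := by rw [conjTranspose_vecMulVec, star_vecOne]
  have hPH : Pᴴ = P := by simp [P, hWH]
  have hPv : ∀ x, P *ᵥ x = x - ((d : ℂ)⁻¹ * (vecOne d ⬝ᵥ x)) • vecOne d := by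
    intro x
    simp [P, W, Matrix.sub_mulVec, Matrix.smul_mulVec, vecMulVec_mulVec, smul_smul]
  have hPone : P *ᵥ vecOne d = 0 := by
    rw [hPv, vecOne_dotProduct_self, inv_mul_cancel₀ hd, one_smul, sub_self]
  have hQ : (P * M * P).PosSemidef := by
    refine .of_dotProduct_mulVec_nonneg ?_ fun x => ?_
    · have := Matrix.isHermitian_conjTranspose_mul_mul P hherm
      rwa [hPH] at this
    · have h1 : vecOne d ⬝ᵥ (P *ᵥ x) = 0 := by
        rw [Matrix.dotProduct_mulVec, ← star_vecOne, ← hPH, ← Matrix.star_mulVec, hPone]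
        simp
      have h2 := hpos _ h1
      rwa [Matrix.star_mulVec, hPH, ← Matrix.dotProduct_mulVec, Matrix.mulVec_mulVec,
        Matrix.mulVec_mulVec] at h2
  obtain ⟨B, hB⟩ := exists_eq_conjTranspose_mul_self hQ
  -- Row by row, this is the vanishing of the traces of the Kraus operators.
  have hBone : B *ᵥ vecOne d = 0 := by
    rw [← Matrix.conjTranspose_mul_self_mulVec_eq_zero, ← hB, ← Matrix.mulVec_mulVec, hPone,
      Matrix.mulVec_zero]
  let K : Fin d × Fin d → Matrix (Fin d) (Fin d) ℂ := fun m =>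
    Matrix.of fun i a => star (B m (i, a))
  let y := M *ᵥ vecOne d
  let c := vecOne d ⬝ᵥ y
  have hc : star c = c := by
    have := hherm.im_star_dotProduct_mulVec_self (vecOne d)
    rw [star_vecOne] at this
    exact Complex.conj_eq_iff_im.mpr this
  have hy : vecOne d ᵥ* M = star y := by
    rw [Matrix.star_mulVec, hherm.eq, star_vecOne]
  -- `M - P M P` consists of two cross terms in `y` and a scalar multiple of `W`; the factor `1 / 2`
  -- shares the scalar term equally between `X ρ` and `ρ X†`.
  let X : Matrix (Fin d) (Fin d) ℂ :=
    Matrix.of fun i a => (d : ℂ)⁻¹ * y (i, a) - (1 / 2) * ((d : ℂ)⁻¹) ^ 2 * c * vecOne d (i, a)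
  have hentry : ∀ p q, (P * M * P) p q = M p q - (d : ℂ)⁻¹ * (vecOne d p * star (y q)) -
      (d : ℂ)⁻¹ * (y p * vecOne d q) + (d : ℂ)⁻¹ ^ 2 * c * (vecOne d p * vecOne d q) := by
    intro p q
    have hWM : W * M = vecMulVec (vecOne d) (star y) := by rw [vecMulVec_mul, hy]
    have hMW : M * W = vecMulVec y (vecOne d) := by rw [mul_vecMulVec]
    have hWMW : W * M * W = c • W := by
      rw [mul_assoc, hMW, vecMulVec_mul_vecMulVec, vecMulVec_smul]
    have : P * M * P = M - (d : ℂ)⁻¹ • (W * M) - (d : ℂ)⁻¹ • (M * W) +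
        ((d : ℂ)⁻¹ ^ 2) • (W * M * W) := by
      simp only [P, sub_mul, mul_sub, one_mul, mul_one, smul_mul_assoc, mul_smul_comm, smul_sub,
        smul_smul, sq]
      abel
    rw [this, hWMW, hWM, hMW]
    simp [W, vecMulVec_apply]
    ring
  have hLeq : L = LinearMap.mulLeft ℂ X + LinearMap.mulRight ℂ Xᴴ + ∑ m, conjMap (K m) := by
    refine choi_injective (Matrix.ext fun p q => ?_)
    have hK : choi (∑ m, conjMap (K m)) p q = (P * M * P) p q := by
      rw [hB, map_sum, Matrix.sum_apply, Matrix.mul_apply]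
      refine Finset.sum_congr rfl fun m _ => ?_
      rw [choi_apply, conjMap_apply, mul_single_mul_conjTranspose_apply]
      simp [K]
    rw [map_add, map_add, Matrix.add_apply, Matrix.add_apply, hK, hentry, choi_mulLeft,
      choi_mulRight]
    have hvq : star (vecOne d q) = vecOne d q := congrFun star_vecOne q
    simp only [X, Matrix.of_apply, star_sub, star_mul', star_pow, star_inv₀, star_natCast, hc, hvq]
    have h2 : star (1 / 2 : ℂ) = 1 / 2 := by simp
    rw [h2]
    ring
  refine ⟨X, K, fun m => ?_, fun ρ => ?_⟩
  · have := congrFun hBone m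
    simp only [Matrix.mulVec, dotProduct, vecOne, Fintype.sum_prod_type, mul_ite, mul_one, mul_zero,
      Finset.sum_ite_eq, Finset.mem_univ, if_true, Pi.zero_apply] at this
    simp only [Matrix.trace, Matrix.diag, K, Matrix.of_apply]
    rw [← star_sum, this, star_zero]
  · conv_lhs => rw [hLeq]
    simp [conjMap_apply]

/-- Nondegeneracy of the trace pairing forces `X + X† = -∑ K† K`, which supplies the anticommutator;
the anti-Hermitian part of `X` is `-i H`. -/
lemma exists_hamiltonian_of_trace_eq_zero {L : SuperOp d} {ι : Type*} [Fintype ι]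
    {X : Matrix (Fin d) (Fin d) ℂ} {K : ι → Matrix (Fin d) (Fin d) ℂ}
    (hL : ∀ ρ, L ρ = X * ρ + ρ * Xᴴ + ∑ m, K m * ρ * (K m)ᴴ) (htr : ∀ ρ, (L ρ).trace = 0) :
    ∃ H : Matrix (Fin d) (Fin d) ℂ, H.IsHermitian ∧
      ∀ ρ, L ρ = -(Complex.I • ⁅H, ρ⁆) + ∑ m, dissipator (K m) ρ := by
  have hS : X + Xᴴ + ∑ m, (K m)ᴴ * K m = 0 := by
    rw [Matrix.ext_iff_trace_mul_right]
    intro ρ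
    rw [zero_mul, Matrix.trace_zero, ← htr ρ, hL]
    simp only [add_mul, Finset.sum_mul, Matrix.trace_add, Matrix.trace_sum]
    rw [Matrix.trace_mul_comm ρ Xᴴ]
    refine congrArg _ (Finset.sum_congr rfl fun m _ => ?_)
    rw [Matrix.trace_mul_comm (K m * ρ), mul_assoc]
  set S := ∑ m, (K m)ᴴ * K m with hSdef
  have hXH : Xᴴ = -X - S := by
    rw [sub_eq_add_neg, ← eq_neg_of_add_eq_zero_left hS, neg_add_cancel_left]
  refine ⟨(Complex.I / 2) • (X - Xᴴ), ?_, fun ρ => ?_⟩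
  · rw [Matrix.IsHermitian, Matrix.conjTranspose_smul, Matrix.conjTranspose_sub,
      Matrix.conjTranspose_conjTranspose, ← neg_sub X Xᴴ, smul_neg, ← neg_smul]
    simp [neg_div]
  · have hdiss : ∑ m, dissipator (K m) ρ =
        ∑ m, K m * ρ * (K m)ᴴ - (1 / 2 : ℂ) • (S * ρ + ρ * S) := by
      simp only [dissipator, Finset.sum_sub_distrib, ← Finset.smul_sum, Finset.sum_add_distrib,
        hSdef, Finset.sum_mul, Finset.mul_sum]
    have hlie : Complex.I • ⁅(Complex.I / 2) • (X - Xᴴ), ρ⁆ =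
        -(1 / 2 : ℂ) • ((X - Xᴴ) * ρ - ρ * (X - Xᴴ)) := by
      rw [Ring.lie_def, smul_mul_assoc, mul_smul_comm, ← smul_sub, smul_smul, ← mul_div_assoc,
        Complex.I_mul_I, neg_div]
    rw [hL, hdiss, hlie, hXH]
    simp only [sub_mul, mul_sub, neg_mul, mul_neg]
    module

end CanonicalForm

/-! ### From the master equation to divisibility and back -/

section MasterEquation

variable {d : ℕ} [NeZero d]

open scoped Matrix.Norms.L2Operator in
omit [NeZero d] in
lemma SolvesMasterEquation.hasDerivWithinAt_choi {L Λ : ℝ → SuperOp d}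
    (hL : SolvesMasterEquation L Λ) (W : SuperOp d) {t : ℝ} (ht : 0 ≤ t) :
    HasDerivWithinAt (fun u => choi (Λ u * W)) (choi (L t * (Λ t * W))) (Ici 0) t := by
  have hentry : ∀ p q, HasDerivWithinAt (fun u => choi (Λ u * W) p q)
      (choi (L t * (Λ t * W)) p q) (Ici 0) t := by
    intro p q
    exact ((Matrix.entryLinearMap ℝ ℂ p.1 q.1).toContinuousLinearMap.hasFDerivAt).comp_hasDerivWithinAt
      t (hL t ht (W (Matrix.single p.2 q.2 1)))
  have hsum := HasDerivWithinAt.fun_sum (u := Finset.univ) fun p _ =>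
    HasDerivWithinAt.fun_sum (u := Finset.univ) fun q _ =>
      (hentry p q).smul_const (Matrix.single p q (1 : ℂ))
  have hmat : ∀ M : Matrix (Fin d × Fin d) (Fin d × Fin d) ℂ,
      ∑ p, ∑ q, M p q • Matrix.single p q (1 : ℂ) = M := fun M => by
    conv_rhs => rw [matrix_eq_sum_single M]
    simp
  simpa only [hmat] using hsum

/-- The right derivative at the identity of completely positive maps is positive on the orthogonal
complement of the vectorised identity. -/
lemma conditionally_posSemidef_of_hasDerivWithinAt {L : SuperOp d} {Φ : ℝ → SuperOp d} {t : ℝ}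
    (h1 : Φ t = 1) (hcp : ∀ u, t < u → IsCompletelyPositive (Φ u))
    (hderiv : open scoped Matrix.Norms.L2Operator in
      HasDerivWithinAt (fun u => choi (Φ u)) (choi L) (Ici t) t) :
    (choi L).IsHermitian ∧
      ∀ x : Fin d × Fin d → ℂ, vecOne d ⬝ᵥ x = 0 → 0 ≤ star x ⬝ᵥ (choi L *ᵥ x) := by
  open scoped Matrix.Norms.L2Operator Topology in
  have hslope : Filter.Tendsto (slope (fun v => choi (Φ v)) t) (𝓝[>] t) (𝓝 (choi L)) := by
    have := hasDerivWithinAt_iff_tendsto_slope.mp hderiv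
    rwa [Ici_sdiff_left] at this
  have hval : ∀ u, slope (fun v => choi (Φ v)) t u =
      (u - t)⁻¹ • (choi (Φ u) - vecMulVec (vecOne d) (vecOne d)) := by
    intro u
    rw [slope, h1, choi_one, vsub_eq_sub]
  constructor
  · have hstar := (continuous_id.matrix_conjTranspose.tendsto (choi L)).comp hslope
    refine tendsto_nhds_unique (hstar.congr' ?_) hslope
    filter_upwards [self_mem_nhdsWithin] with u hu
    simp only [Function.comp_apply, id, hval]
    rw [Matrix.conjTranspose_smul, Matrix.conjTranspose_sub, conjTranspose_vecMulVec, star_vecOne,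
      (hcp u hu).posSemidef_choi.isHermitian.eq, star_trivial]
  · intro x hx
    have hquad : Continuous fun M : Matrix (Fin d × Fin d) (Fin d × Fin d) ℂ =>
        star x ⬝ᵥ (M *ᵥ x) :=
      continuous_const.dotProduct (continuous_id.matrix_mulVec continuous_const)
    refine ge_of_tendsto ((hquad.tendsto (choi L)).comp hslope) ?_
    filter_upwards [self_mem_nhdsWithin] with u hu
    have hpos : 0 ≤ (u - t)⁻¹ := inv_nonneg.mpr (sub_nonneg.mpr (le_of_lt hu))
    simp only [Function.comp_apply, hval]
    -- Orthogonality to `vecOne d` removes the contribution of the identity map, leaving a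
    -- nonnegative multiple of the form of `choi (Φ u)`.
    rw [Matrix.smul_mulVec, Matrix.sub_mulVec, vecMulVec_mulVec, hx]
    simpa using smul_nonneg hpos ((hcp u hu).posSemidef_choi.dotProduct_mulVec_nonneg x)

variable {L Λ : ℝ → SuperOp d}

omit [NeZero d] in
lemma trace_generator_eq_zero (hΛ : IsDynamicalMap Λ) (hL : SolvesMasterEquation L Λ)
    (hinv : ∀ t : ℝ, 0 ≤ t → IsUnit (Λ t)) {t : ℝ} (ht : 0 ≤ t)
    (ρ : Matrix (Fin d) (Fin d) ℂ) : (L t ρ).trace = 0 := by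
  obtain ⟨W, hW, -⟩ := isUnit_iff_exists.mp (hinv t ht)
  have hρ : Λ t (W ρ) = ρ := by rw [← Module.End.mul_apply, hW, Module.End.one_apply]
  have h1 : HasDerivWithinAt (fun u => (Λ u (W ρ)).trace) (L t ρ).trace (Ici 0) t := by
    open scoped Matrix.Norms.L2Operator in
    have := ((Matrix.traceLinearMap (Fin d) ℝ ℂ).toContinuousLinearMap.hasFDerivAt).comp_hasDerivWithinAt
      t (hL t ht (W ρ))
    rwa [hρ] at this
  have h2 : HasDerivWithinAt (fun u => (Λ u (W ρ)).trace) 0 (Ici 0) t :=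
    (hasDerivWithinAt_const t (Ici 0) (W ρ).trace).congr
      (fun u hu => hΛ.tracePreserving u hu _) (hΛ.tracePreserving t ht _)
  exact (uniqueDiffOn_Ici (0 : ℝ) t ht).eq_deriv _ h1 h2

open scoped Matrix.Norms.L2Operator in
lemma IsDivisible.exists_dissipator (hdiv : IsDivisible Λ) (hΛ : IsDynamicalMap Λ)
    (hL : SolvesMasterEquation L Λ) (hinv : ∀ t : ℝ, 0 ≤ t → IsUnit (Λ t)) {t : ℝ} (ht : 0 ≤ t) :
    ∃ (H : Matrix (Fin d) (Fin d) ℂ) (K : Fin d × Fin d → Matrix (Fin d) (Fin d) ℂ),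
      H.IsHermitian ∧ (∀ m, (K m).trace = 0) ∧
        ∀ ρ, L t ρ = -(Complex.I • ⁅H, ρ⁆) + ∑ m, dissipator (K m) ρ := by
  obtain ⟨W, hW, -⟩ := isUnit_iff_exists.mp (hinv t ht)
  have hcp : ∀ u, t < u → IsCompletelyPositive (Λ u * W) := by
    intro u hu
    obtain ⟨V, hV, hVΛ⟩ := hdiv t u ht hu.le
    rwa [hVΛ, mul_assoc, hW, mul_one]
  have hderiv := (hL.hasDerivWithinAt_choi W ht).mono (Ici_subset_Ici.mpr ht)
  rw [hW, mul_one] at hderiv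
  obtain ⟨hherm, hpos⟩ := conditionally_posSemidef_of_hasDerivWithinAt hW hcp hderiv
  obtain ⟨X, K, hK, hX⟩ := exists_traceless_kraus hherm hpos
  obtain ⟨H, hH, hHL⟩ := exists_hamiltonian_of_trace_eq_zero hX
    (trace_generator_eq_zero hΛ hL hinv ht)
  exact ⟨H, K, hH, hK, hHL⟩

open scoped Matrix.Norms.L2Operator in
lemma isDivisible_of_isGKSL (hΛ : IsDynamicalMap Λ) (hL : SolvesMasterEquation L Λ)
    (hinv : ∀ t : ℝ, 0 ≤ t → IsUnit (Λ t)) (hG : ∀ t : ℝ, 0 ≤ t → IsGKSL (L t)) :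
    IsDivisible Λ := by
  intro s t hs hst
  obtain ⟨W, hW, hW'⟩ := isUnit_iff_exists.mp (hinv s hs)
  -- The inverse need not be positive, but it preserves adjoints, so the propagators have Hermitian
  -- Choi matrices, as the defect argument requires.
  have hWherm : ∀ X, W Xᴴ = (W X)ᴴ := by
    intro X
    have h : ∀ Y, W (Λ s Y) = Y := fun Y => by
      rw [← Module.End.mul_apply, hW', Module.End.one_apply]
    have h' : ∀ Y, Λ s (W Y) = Y := fun Y => by
      rw [← Module.End.mul_apply, hW, Module.End.one_apply]
    rw [← h (W X)ᴴ, (hΛ.completelyPositive s hs).map_conjTranspose, h']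
  have hderiv := fun (u : ℝ) (hu : 0 ≤ u) => hL.hasDerivWithinAt_choi W hu
  refine ⟨Λ t * W, ?_, by rw [mul_assoc, hW', mul_one]⟩
  refine isCompletelyPositive_of_hasDerivWithinAt hst (Φ := fun u => Λ u * W)
    (fun u hu => hG u (hs.trans hu.1)) (fun u hu => ?_) (fun u hu => ?_) (fun u hu => ?_) ?_
  · exact (hderiv u (hs.trans hu.1)).continuousWithinAt.mono
      (Icc_subset_Ici_self.trans (Ici_subset_Ici.mpr hs))
  · exact (hderiv u (hs.trans hu.1)).mono (Ici_subset_Ici.mpr (hs.trans hu.1))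
  · refine isHermitian_choi fun X => ?_
    rw [Module.End.mul_apply, hWherm,
      (hΛ.completelyPositive u (hs.trans hu.1)).map_conjTranspose, Module.End.mul_apply]
  · simp only [hW]
    rw [isCompletelyPositive_iff_posSemidef_choi, choi_one]
    have := Matrix.posSemidef_vecMulVec_self_star (vecOne d)
    rwa [star_vecOne] at this

end MasterEquation

theorem theorem2 {d : ℕ} [NeZero d] (L Λ : ℝ → SuperOp d)
    (hΛ : IsDynamicalMap Λ)
    (hL : SolvesMasterEquation L Λ)
    (hinv : ∀ t : ℝ, 0 ≤ t → IsUnit (Λ t)) :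
    (IsDivisible Λ ↔ ∀ t : ℝ, 0 ≤ t → IsGKSL (L t)) ∧
    (∀ F : Fin (d ^ 2) → Matrix (Fin d) (Fin d) ℂ, IsOperatorBasis F →
      (IsDivisible Λ ↔ ∀ t : ℝ, 0 ≤ t → IsGKSLWith F (L t))) := by
  refine ⟨⟨fun h t ht => ?_, isDivisible_of_isGKSL hΛ hL hinv⟩, fun F hF =>
    ⟨fun h t ht => ?_, fun h => isDivisible_of_isGKSL hΛ hL hinv fun t ht => (h t ht).isGKSL⟩⟩
  · obtain ⟨H, K, hH, -, hHL⟩ := h.exists_dissipator hΛ hL hinv ht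
    exact isGKSL_of_dissipator hH K hHL
  · obtain ⟨H, K, hH, hK, hHL⟩ := h.exists_dissipator hΛ hL hinv ht
    exact hF.isGKSLWith hH hK hHL
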